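/- **Setting.** Consider $M$ access points (APs) with $N$ antennas each and $K$ single-antenna users (UEs). The channel between AP $m$ and UE $k$ is $\mathbf g_{mk}=\bar{\mathbf g}_{mk}+\check{\mathbf g}_{mk}\in\mathbb C^N$ with $\bar{\mathbf g}_{mk}$ deterministic and $\check{\mathbf g}_{mk}\sim\mathcal N_{\mathbb C}(\mathbf 0,\check{\mathbf R}_{mk})$ (circularly symmetric complex Gaussian). A coherence block has $\tau_c=\tau_p+\tau_u+\tau_d$ channel uses. Each UE uses one of $\tau_p$ orthogonal pilots; $\mathcal P_k$ is the set of UEs with the same pilot as UE $k$ (including $k$). With uplink powers $p_l\ge 0$ and noise power $\sigma^2>0$, the despread pilot signal is $\mathbf y_{mk}=\sum_{l\in\mathcal P_k}\sqrt{p_l}\,\tau_p\,\mathbf g_{ml}+\mathbf n_{mk}$ with $\mathbf n_{mk}\sim\mathcal N_{\mathbb C}(\mathbf 0,\tau_p\sigma^2\mathbf I_N)$. For each $k$, all the vectors $\check{\mathbf g}_{ml}$ ($1\le m\le M$, $1\le l\le K$) and $\mathbf n_{mk}$ ($1\le m\le M$) are mutually independent. The channel estimate is $\hat{\mathbf g}_{mk}=\bar{\mathbf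 g}_{mk}+\mathbf A_{mk}(\mathbf y_{mk}-\bar{\mathbf y}_{mk})$ with $\bar{\mathbf y}_{mk}=\sum_{l\in\mathcal P_k}\sqrt{p_l}\,\tau_p\,\bar{\mathbf g}_{ml}$ and an arbitrary deterministic $\mathbf A_{mk}\in\mathbb C^{N\times N}$. The downlink precoder is $\mathbf f_{mk}=\eta_{mk}\mathbf W_{mk}\hat{\mathbf g}_{mk}$ with an arbitrary deterministic $\mathbf W_{mk}\in\mathbb C^{N\times N}$ and $\eta_{mk}=\sqrt{p_{mk}/\mathbb E\{\|\mathbf W_{mk}\hat{\mathbf g}_{mk}\|^2\}}$, $p_{mk}\ge 0$ (with $\eta_{mk}=0$ if $\mathbf W_{mk}\hat{\mathbf g}_{mk}=\mathbf 0$ almost surely). The use-and-then-forget downlink SINR and spectral efficiency of UE $k$ are $$\mathrm{SINR}_k^{\mathrm{dl}}=\frac{\big|\sum_{m}\mathbb E\{\mathbf f_{mk}^H\mathbf g_{mk}\}\big|^2}{\sum_{l=1}^K\mathbb E\{|\sum_{m}\mathbf f_{ml}^H\mathbf g_{mk}|^2\}-\big|\sum_{m}\mathbb E\{\mathbf f_{mk}^H\mathbf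 g_{mk}\}\big|^2+\sigma^2},\qquad \mathrm{SE}_k^{\mathrm{dl}}=\frac{\tau_d}{\tau_c}\log_2(1+\mathrm{SINR}_k^{\mathrm{dl}}).$$ **Notation.** $\bar{\mathbf G}_{mkl}=\bar{\mathbf g}_{mk}\bar{\mathbf g}_{ml}^H$, $\mathbf\Psi_{mk}=\sum_{l\in\mathcal P_k}p_l\tau_p\check{\mathbf R}_{ml}+\sigma^2\mathbf I_N$, $\tilde{\mathbf R}_{mk}=\tau_p\mathbf A_{mk}\mathbf\Psi_{mk}\mathbf A_{mk}^H$, $\bar{\mathbf R}_{mk}=\bar{\mathbf G}_{mkk}+\sqrt{p_k}\,\tau_p\check{\mathbf R}_{mk}\mathbf A_{mk}^H$, $\tilde{\mathbf B}_{mlk}=\bar{\mathbf G}_{mlk}+\sqrt{p_k}\,\tau_p\mathbf A_{ml}\check{\mathbf R}_{mk}$. **Theorem.** All the expectations above are finite, and $$\mathbb E\{\|\mathbf W_{mk}\hat{\mathbf g}_{mk}\|^2\}=\mathrm{tr}(\mathbf W_{mk}^H\mathbf W_{mk}\bar{\mathbf G}_{mkk})+\mathrm{tr}(\mathbf W_{mk}^H\mathbf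 W_{mk}\tilde{\mathbf R}_{mk}).$$ Hence $\eta_{mk}=\bar\eta_{mk}$, where $$\bar\eta_{mk}=\sqrt{\frac{p_{mk}}{\mathrm{tr}(\mathbf W_{mk}^H\mathbf W_{mk}\bar{\mathbf G}_{mkk})+\mathrm{tr}(\mathbf W_{mk}^H\mathbf W_{mk}\tilde{\mathbf R}_{mk})}}$$ (and $\bar\eta_{mk}=0$ if the denominator is $0$). For every UE $k$ the denominator of $\mathrm{SINR}_k^{\mathrm{dl}}$ is positive and $\mathrm{SINR}_k^{\mathrm{dl}}=\overline{\mathrm{SINR}}_k^{\mathrm{dl}}$, the numerators and the denominators being equal separately, where $$\overline{\mathrm{SINR}}_k^{\mathrm{dl}}=\frac{\big|\sum_m\bar\eta_{mk}\mathrm{tr}(\mathbf W_{mk}^H\bar{\mathbf R}_{mk})\big|^2}{\sum_{l=1}^K\sum_m\mu_{mkl}+\sum_{l\in\mathcal P_k}\sum_m\omega_{mkl}+\sum_{l=1}^K\big(|\sum_m\lambda_{mkl}|^2-\sum_m|\lambda_{mkl}|^2\big)-\big|\sum_m\bar\eta_{mk}\mathrm{tr}(\mathbf W_{mk}^H\bar{\mathbf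 R}_{mk})\big|^2+\sigma^2}$$ with $$\mu_{mkl}=\bar\eta_{ml}^2\big[\mathrm{tr}(\mathbf W_{ml}^H\bar{\mathbf G}_{mkk}\mathbf W_{ml}\bar{\mathbf G}_{mll})+\mathrm{tr}(\mathbf W_{ml}^H\check{\mathbf R}_{mk}\mathbf W_{ml}\tilde{\mathbf R}_{ml})+\mathrm{tr}(\mathbf W_{ml}^H\check{\mathbf R}_{mk}\mathbf W_{ml}\bar{\mathbf G}_{mll})+\mathrm{tr}(\mathbf W_{ml}^H\bar{\mathbf G}_{mkk}\mathbf W_{ml}\tilde{\mathbf R}_{ml})\big],$$ $$\omega_{mkl}=\bar\eta_{ml}^2\sqrt{p_k}\,\tau_p\,\mathrm{tr}(\mathbf W_{ml}^H\check{\mathbf R}_{mk}\mathbf A_{ml}^H)\,\mathrm{tr}(\mathbf W_{ml}\bar{\mathbf G}_{mlk})+\bar\eta_{ml}^2\sqrt{p_k}\,\tau_p\,\mathrm{tr}(\mathbf W_{ml}^H\bar{\mathbf G}_{mkl})\,\mathrm{tr}(\mathbf W_{ml}\mathbf A_{ml}\check{\mathbf R}_{mk})+\bar\eta_{ml}^2p_k\tau_p^2\,|\mathrm{tr}(\mathbf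 W_{ml}^H\check{\mathbf R}_{mk}\mathbf A_{ml}^H)|^2,$$ and $\lambda_{mkl}=\bar\eta_{ml}\mathrm{tr}(\mathbf W_{ml}\bar{\mathbf G}_{mlk})$ for $l\notin\mathcal P_k$, $\lambda_{mkl}=\bar\eta_{ml}\mathrm{tr}(\mathbf W_{ml}\tilde{\mathbf B}_{mlk})$ for $l\in\mathcal P_k$. Consequently $\mathrm{SE}_k^{\mathrm{dl}}=\frac{\tau_d}{\tau_c}\log_2(1+\overline{\mathrm{SINR}}_k^{\mathrm{dl}})$. -/

import Mathlib

open MeasureTheory ProbabilityTheory Matrix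

noncomputable section

namespace CellFree

/-! ### Circularly symmetric complex Gaussian vectors -/

/-- The law of `a + i b` with `a`, `b` independent real Gaussians of mean `0` and variance `1/2`:
the standard circularly symmetric complex Gaussian law on `ℂ`. -/
def stdComplexNormal : Measure ℂ :=
  ((gaussianReal 0 (1 / 2)).prod (gaussianReal 0 (1 / 2))).map
    (fun q : ℝ × ℝ => (⟨q.1, q.2⟩ : ℂ))

/-- The standard circularly symmetric complex Gaussian law on `ℂ^N` (i.i.d. entries). -/
def stdComplexNormalVec (N : ℕ) : Measure (Fin N → ℂ) :=
  Measure.pi (fun _ => stdComplexNormal)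

/-- The random vector `X` has the law `𝒩_ℂ(μ, R)`: it is distributed as `μ + L z` with `z`
standard and `L Lᴴ = R`. The law of `μ + L z` depends on `L` only through `L Lᴴ`; a factor `L`
exists exactly when `R` is positive semidefinite. -/
def HasComplexNormalLaw {Ω : Type*} [MeasurableSpace Ω] (ν : Measure Ω) {N : ℕ}
    (X : Ω → Fin N → ℂ) (μ : Fin N → ℂ) (R : Matrix (Fin N) (Fin N) ℂ) : Prop :=
  AEMeasurable X ν ∧ ∃ L : Matrix (Fin N) (Fin N) ℂ, L * Lᴴ = R ∧
    ν.map X = (stdComplexNormalVec N).map (fun z => μ + L *ᵥ z)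

/-! ### Deterministic (statistical) data of the network -/

/-- The deterministic data of a network with `M` access points (APs) of `N` antennas each and
`K` single-antenna users (UEs). -/
structure Network (M K N : ℕ) where
  /-- Numbers of channel uses per coherence block for pilots, uplink data and downlink data. -/
  τp : ℕ
  τu : ℕ
  τd : ℕ
  /-- The index of the pilot used by each UE, among `τp` orthogonal pilots. -/
  pilot : Fin K → Fin τp
  /-- The uplink transmit power `p_k` of UE `k`. -/
  p : Fin K → ℝ
  p_nonneg : ∀ k, 0 ≤ p k
  /-- The power `p_{mk}` that AP `m` allocates to UE `k` in the downlink. -/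
  pdl : Fin M → Fin K → ℝ
  pdl_nonneg : ∀ m k, 0 ≤ pdl m k
  /-- The noise power `σ²`. -/
  noise : ℝ
  noise_pos : 0 < noise
  /-- The line-of-sight components `ḡ_{mk}`. -/
  gbar : Fin M → Fin K → Fin N → ℂ
  /-- The correlation matrices `Ř_{mk}` of the non-line-of-sight components. -/
  R : Fin M → Fin K → Matrix (Fin N) (Fin N) ℂ
  /-- The estimator matrices `A_{mk}`. -/
  A : Fin M → Fin K → Matrix (Fin N) (Fin N) ℂ
  /-- The bilinear equalizer matrices `W_{mk}`. -/
  W : Fin M → Fin K → Matrix (Fin N) (Fin N) ℂ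

namespace Network

variable {M K N : ℕ} (S : Network M K N)

/-- The length `τ_c` of a coherence block. -/
def τc : ℕ := S.τp + S.τu + S.τd

/-- `𝒫_k`: the UEs that use the same pilot as UE `k`, including `k` itself. -/
def P (k : Fin K) : Finset (Fin K) := Finset.univ.filter (fun l => S.pilot l = S.pilot k)

/-! ### The random quantities -/

section Random

variable {Ω : Type*} (gcheck nP : Fin M → Fin K → Ω → Fin N → ℂ)

/-- The channel `g_{mk} = ḡ_{mk} + ǧ_{mk}`. -/
def g (m : Fin M) (k : Fin K) (ω : Ω) : Fin N → ℂ := S.gbar m k + gcheck m k ω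

/-- The despread pilot signal `y_{mk} = ∑_{l ∈ 𝒫_k} √p_l τ_p g_{ml} + n_{mk}`. -/
def y (m : Fin M) (k : Fin K) (ω : Ω) : Fin N → ℂ :=
  (∑ l ∈ S.P k, ((Real.sqrt (S.p l) * S.τp : ℝ) : ℂ) • S.g gcheck m l ω) + nP m k ω

/-- `ȳ_{mk} = ∑_{l ∈ 𝒫_k} √p_l τ_p ḡ_{ml}`. -/
def ybar (m : Fin M) (k : Fin K) : Fin N → ℂ :=
  ∑ l ∈ S.P k, ((Real.sqrt (S.p l) * S.τp : ℝ) : ℂ) • S.gbar m l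

/-- The channel estimate `ĝ_{mk} = ḡ_{mk} + A_{mk} (y_{mk} - ȳ_{mk})`. -/
def ghat (m : Fin M) (k : Fin K) (ω : Ω) : Fin N → ℂ :=
  S.gbar m k + S.A m k *ᵥ (S.y gcheck nP m k ω - S.ybar m k)

/-- The unscaled bilinear equalizer precoder `W_{mk} ĝ_{mk}`. -/
def fbar (m : Fin M) (k : Fin K) (ω : Ω) : Fin N → ℂ := S.W m k *ᵥ S.ghat gcheck nP m k ω

variable [MeasurableSpace Ω] (ν : Measure Ω)

/-- The probabilistic model of the channels and of the pilot noise. The noise vectors of two UEs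
at the same AP may be dependent (they coincide for UEs that share a pilot), so independence is
asked for the channels together with the noise vectors of one UE at all APs. -/
structure IsRicianModel : Prop where
  channel_law : ∀ m k, HasComplexNormalLaw ν (gcheck m k) 0 (S.R m k)
  noise_law : ∀ m k, HasComplexNormalLaw ν (nP m k) 0
    (((S.τp * S.noise : ℝ) : ℂ) • (1 : Matrix (Fin N) (Fin N) ℂ))
  indep : ∀ k, iIndepFun
    (Sum.elim (fun i : Fin M × Fin K => gcheck i.1 i.2) (fun m : Fin M => nP m k)) ν

/-- `𝔼 ‖W_{mk} ĝ_{mk}‖²` (Euclidean norm). -/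
def meanSqPrecoder (m : Fin M) (k : Fin K) : ℝ :=
  ∫ ω, ‖WithLp.toLp 2 (S.fbar gcheck nP m k ω)‖ ^ 2 ∂ν

/-- The power factor `η_{mk} = √(p_{mk} / 𝔼 ‖W_{mk} ĝ_{mk}‖²)`; it is `0` when the precoder
vanishes almost surely. -/
def eta (m : Fin M) (k : Fin K) : ℝ :=
  Real.sqrt (S.pdl m k / S.meanSqPrecoder gcheck nP ν m k)

/-- The precoding vector `f_{mk} = η_{mk} W_{mk} ĝ_{mk}`. -/
def f (m : Fin M) (k : Fin K) (ω : Ω) : Fin N → ℂ :=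
  ((S.eta gcheck nP ν m k : ℝ) : ℂ) • S.fbar gcheck nP m k ω

/-- The effective gain `f_{ml}ᴴ g_{mk}`. -/
def gain (m : Fin M) (l k : Fin K) (ω : Ω) : ℂ :=
  star (S.f gcheck nP ν m l ω) ⬝ᵥ S.g gcheck m k ω

/-- The numerator of the use-and-then-forget downlink SINR. -/
def sinrNum (k : Fin K) : ℝ := ‖∑ m, (∫ ω, S.gain gcheck nP ν m k k ω ∂ν)‖ ^ 2

/-- The denominator of the use-and-then-forget downlink SINR. -/
def sinrDen (k : Fin K) : ℝ :=
  (∑ l, (∫ ω, ‖∑ m, S.gain gcheck nP ν m l k ω‖ ^ 2 ∂ν))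
    - ‖∑ m, (∫ ω, S.gain gcheck nP ν m k k ω ∂ν)‖ ^ 2 + S.noise

/-- The use-and-then-forget downlink SINR of UE `k`. -/
def sinr (k : Fin K) : ℝ := S.sinrNum gcheck nP ν k / S.sinrDen gcheck nP ν k

/-- The achievable downlink spectral efficiency of UE `k`. -/
def se (k : Fin K) : ℝ :=
  (S.τd / S.τc : ℝ) * Real.logb 2 (1 + S.sinr gcheck nP ν k)

end Random

/-! ### The closed-form quantities -/

/-- `Ψ_{mk} = ∑_{l ∈ 𝒫_k} p_l τ_p Ř_{ml} + σ² I`. -/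
def Psi (m : Fin M) (k : Fin K) : Matrix (Fin N) (Fin N) ℂ :=
  (∑ l ∈ S.P k, ((S.p l * S.τp : ℝ) : ℂ) • S.R m l) + (S.noise : ℂ) • 1

/-- `Ḡ_{mkl} = ḡ_{mk} ḡ_{ml}ᴴ`. -/
def Gbar (m : Fin M) (k l : Fin K) : Matrix (Fin N) (Fin N) ℂ :=
  vecMulVec (S.gbar m k) (star (S.gbar m l))

/-- `R̄_{mk} = Ḡ_{mkk} + √p_k τ_p Ř_{mk} A_{mk}ᴴ`. -/
def Rbar (m : Fin M) (k : Fin K) : Matrix (Fin N) (Fin N) ℂ :=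
  S.Gbar m k k + ((Real.sqrt (S.p k) * S.τp : ℝ) : ℂ) • (S.R m k * (S.A m k)ᴴ)

/-- `R̃_{mk} = τ_p A_{mk} Ψ_{mk} A_{mk}ᴴ`. -/
def Rtilde (m : Fin M) (k : Fin K) : Matrix (Fin N) (Fin N) ℂ :=
  (S.τp : ℂ) • (S.A m k * S.Psi m k * (S.A m k)ᴴ)

/-- `B̃_{mlk} = Ḡ_{mlk} + √p_k τ_p A_{ml} Ř_{mk}`. -/
def Btilde (m : Fin M) (l k : Fin K) : Matrix (Fin N) (Fin N) ℂ :=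
  S.Gbar m l k + ((Real.sqrt (S.p k) * S.τp : ℝ) : ℂ) • (S.A m l * S.R m k)

/-- `tr(Wᴴ W Ḡ_{mkk}) + tr(Wᴴ W R̃_{mk})` with `W = W_{mk}`. -/
def powerTrace (m : Fin M) (k : Fin K) : ℂ :=
  trace ((S.W m k)ᴴ * S.W m k * S.Gbar m k k) + trace ((S.W m k)ᴴ * S.W m k * S.Rtilde m k)

/-- The closed-form power factor `η̄_{mk}`. -/
def etaBar (m : Fin M) (k : Fin K) : ℝ := Real.sqrt (S.pdl m k / (S.powerTrace m k).re)

/-- The term `μ_{mkl}`. -/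
def mu (m : Fin M) (k l : Fin K) : ℂ :=
  (S.etaBar m l : ℂ) ^ 2 * trace ((S.W m l)ᴴ * S.Gbar m k k * S.W m l * S.Gbar m l l)
  + (S.etaBar m l : ℂ) ^ 2 * trace ((S.W m l)ᴴ * S.R m k * S.W m l * S.Rtilde m l)
  + (S.etaBar m l : ℂ) ^ 2 * trace ((S.W m l)ᴴ * S.R m k * S.W m l * S.Gbar m l l)
  + (S.etaBar m l : ℂ) ^ 2 * trace ((S.W m l)ᴴ * S.Gbar m k k * S.W m l * S.Rtilde m l)

/-- The term `ω_{mkl}`. -/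
def omega (m : Fin M) (k l : Fin K) : ℂ :=
  (S.etaBar m l : ℂ) ^ 2 * (Real.sqrt (S.p k) : ℂ) * (S.τp : ℂ)
      * trace ((S.W m l)ᴴ * S.R m k * (S.A m l)ᴴ) * trace (S.W m l * S.Gbar m l k)
  + (S.etaBar m l : ℂ) ^ 2 * (Real.sqrt (S.p k) : ℂ) * (S.τp : ℂ)
      * trace ((S.W m l)ᴴ * S.Gbar m k l) * trace (S.W m l * S.A m l * S.R m k)
  + (S.etaBar m l : ℂ) ^ 2 * (S.p k : ℂ) * (S.τp : ℂ) ^ 2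
      * ((‖trace ((S.W m l)ᴴ * S.R m k * (S.A m l)ᴴ)‖ ^ 2 : ℝ) : ℂ)

/-- The term `λ_{mkl}`. -/
def lam (m : Fin M) (k l : Fin K) : ℂ :=
  if l ∈ S.P k then (S.etaBar m l : ℂ) * trace (S.W m l * S.Btilde m l k)
  else (S.etaBar m l : ℂ) * trace (S.W m l * S.Gbar m l k)

/-- The numerator of the closed-form downlink SINR. -/
def closedNum (k : Fin K) : ℝ :=
  ‖∑ m, (S.etaBar m k : ℂ) * trace ((S.W m k)ᴴ * S.Rbar m k)‖ ^ 2

/-- The denominator of the closed-form downlink SINR, a complex expression. -/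
def closedDen (k : Fin K) : ℂ :=
  (∑ l, ∑ m, S.mu m k l) + (∑ l ∈ S.P k, ∑ m, S.omega m k l)
  + (∑ l, ((‖∑ m, S.lam m k l‖ ^ 2 - ∑ m, ‖S.lam m k l‖ ^ 2 : ℝ) : ℂ))
  - (S.closedNum k : ℂ) + (S.noise : ℂ)

/-- The closed-form downlink SINR, a complex expression. -/
def closedSinr (k : Fin K) : ℂ := (S.closedNum k : ℂ) / S.closedDen k

/-- The closed-form downlink spectral efficiency. -/
def closedSe (k : Fin K) : ℝ :=
  (S.τd / S.τc : ℝ) * Real.logb 2 (1 + (S.closedSinr k).re)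

end Network

end CellFree

end

/-! For a fixed UE `l`, every precoder for `l` and every channel is an affine image of one family of
independent Gaussian vectors: all channels together with the pilot noise of `l`. Each expectation in
the theorem is therefore a moment of affine forms in independent standard complex Gaussians, and
Wick's formula (`integral_linForm`) evaluates it. Since moments of degree (2,2) are finite,
integrability comes along.

For `|∑_m f_mᴴ g_m|²` the first Wick pairing gives `|∑_m E f_mᴴ g_m|²`. The second gives traces of
products of second-moment matrices, minus the pure mean part
(`integrable_integral_norm_sum_dotProduct`). Distinct APs see uncorrelated channels and precoders,
so only the diagonal of the double sum over APs survives, as three traces per AP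
(`integral_norm_sum_dotProduct_of_uncorrelated`).

The rest is algebra. The mean gain is the conjugate of `λ` (`trace_moment_eq_conj_lam`), and the
three traces equal `μ + ω - |λ|²`, with `ω` present only for UEs sharing a pilot
(`mu_add_omega_sub_lam`). Summing over the APs produces the closed form. Positivity of the
denominator is Jensen's inequality plus positive noise. -/

noncomputable section

namespace CellFree

open scoped ComplexConjugate NNReal

/-! ### Moments of the standard complex Gaussian. -/

section OneDimensional

/-- The moment generating function is finite on the whole line, so its derivatives at 0 are the
moments. -/
theorem integral_pow_gaussianReal_eq (v : ℝ≥0) (n : ℕ) :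
    ∫ x, x ^ n ∂(gaussianReal 0 v)
      = iteratedDeriv n (fun t : ℝ => Real.exp (v * t ^ 2 / 2)) 0 := by
  have h := iteratedDeriv_mgf_zero (X := id) (μ := gaussianReal 0 v)
    (by rw [integrableExpSet_id_gaussianReal]; simp) n
  rw [mgf_id_gaussianReal] at h
  simpa using h.symm

theorem moments_gaussianReal_half :
    ∫ x, x ∂(gaussianReal 0 (1 / 2)) = 0 ∧ ∫ x, x ^ 2 ∂(gaussianReal 0 (1 / 2)) = 1 / 2 ∧
      ∫ x, x ^ 4 ∂(gaussianReal 0 (1 / 2)) = 3 / 4 := by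
  refine ⟨by simp, ?_, ?_⟩
  all_goals
    rw [integral_pow_gaussianReal_eq]
    -- The generating function is `exp (t²/4)`. Each differentiation turns a polynomial prefactor
    -- `P` into `P' + t P / 2`.
    have d0 (t : ℝ) : HasDerivAt (fun t : ℝ => Real.exp ((1 / 2 : ℝ≥0) * t ^ 2 / 2))
        (t / 2 * Real.exp ((1 / 2 : ℝ≥0) * t ^ 2 / 2)) t := by
      convert! ((((hasDerivAt_id t).pow 2).const_mul ((1 / 2 : ℝ≥0) : ℝ)).div_const 2).exp using 1
      simp; ring
    have e1 := funext fun t => (d0 t).deriv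
    have d1 (t : ℝ) : HasDerivAt (fun t : ℝ => t / 2 * Real.exp ((1 / 2 : ℝ≥0) * t ^ 2 / 2))
        ((1 / 2 + t ^ 2 / 4) * Real.exp ((1 / 2 : ℝ≥0) * t ^ 2 / 2)) t := by
      convert! ((hasDerivAt_id t).div_const 2).mul (d0 t) using 1
      simp; ring
    have e2 := funext fun t => (d1 t).deriv
    have d2 (t : ℝ) : HasDerivAt
        (fun t : ℝ => (1 / 2 + t ^ 2 / 4) * Real.exp ((1 / 2 : ℝ≥0) * t ^ 2 / 2))
        ((3 * t / 4 + t ^ 3 / 8) * Real.exp ((1 / 2 : ℝ≥0) * t ^ 2 / 2)) t := by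
      convert! ((((hasDerivAt_id t).pow 2).div_const 4).const_add (1 / 2)).mul (d0 t) using 1
      simp; ring
    have e3 := funext fun t => (d2 t).deriv
    have d3 : HasDerivAt
        (fun t : ℝ => (3 * t / 4 + t ^ 3 / 8) * Real.exp ((1 / 2 : ℝ≥0) * t ^ 2 / 2)) (3 / 4) 0 := by
      convert! ((((hasDerivAt_id (0 : ℝ)).const_mul 3).div_const 4).add
        (((hasDerivAt_id (0 : ℝ)).pow 3).div_const 8)).mul (d0 0) using 1
      simp
    simp only [iteratedDeriv_succ, iteratedDeriv_zero, e1, e2, e3, d3.deriv]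
    try norm_num

theorem measurable_complexMk : Measurable (fun q : ℝ × ℝ => (⟨q.1, q.2⟩ : ℂ)) :=
  Complex.measurableEquivRealProd.symm.measurable

instance isProbabilityMeasure_stdComplexNormal : IsProbabilityMeasure stdComplexNormal :=
  Measure.isProbabilityMeasure_map measurable_complexMk.aemeasurable

theorem measurePreserving_complexMk :
    MeasurePreserving (fun q : ℝ × ℝ => (⟨q.1, q.2⟩ : ℂ))
      ((gaussianReal 0 (1 / 2)).prod (gaussianReal 0 (1 / 2))) stdComplexNormal :=
  ⟨measurable_complexMk, rfl⟩

theorem integral_stdComplexNormal (f : ℂ → ℂ) :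
    ∫ z, f z ∂stdComplexNormal = ∫ q : ℝ × ℝ, f ⟨q.1, q.2⟩
      ∂((gaussianReal 0 (1 / 2)).prod (gaussianReal 0 (1 / 2))) :=
  (measurePreserving_complexMk.integral_comp
    Complex.measurableEquivRealProd.symm.measurableEmbedding f).symm

/-- All moments of the standard complex normal law are finite. -/
theorem memLp_stdComplexNormal (p : ℝ≥0) : MemLp (fun z : ℂ => z) p stdComplexNormal := by
  rw [← measurePreserving_complexMk.map_eq,
    memLp_map_measure_iff measurable_id'.aestronglyMeasurable measurable_complexMk.aemeasurable]
  have h1 := (memLp_id_gaussianReal (μ := 0) (v := 1 / 2) p).comp_fst (gaussianReal 0 (1 / 2))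
  have h2 := (memLp_id_gaussianReal (μ := 0) (v := 1 / 2) p).comp_snd (gaussianReal 0 (1 / 2))
  refine (h1.norm.add h2.norm).mono measurable_complexMk.aestronglyMeasurable (.of_forall ?_)
  intro q
  refine (Complex.norm_le_abs_re_add_abs_im _).trans (le_of_eq ?_)
  exact (abs_of_nonneg (add_nonneg (abs_nonneg q.1) (abs_nonneg q.2))).symm

theorem integrable_stdComplexNormal (n m : ℕ) :
    Integrable (fun z : ℂ => z ^ n * conj z ^ m) stdComplexNormal := by
  have h := (memLp_stdComplexNormal (n + m : ℕ)).integrable_norm_pow'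
  refine h.mono' (by fun_prop) (.of_forall fun z => ?_)
  simp [pow_add]

/-- The standard complex normal law is invariant under multiplication by `i`. -/
theorem integral_stdComplexNormal_rotate (f : ℂ → ℂ) :
    ∫ z, f (Complex.I * z) ∂stdComplexNormal = ∫ z, f z ∂stdComplexNormal := by
  rw [integral_stdComplexNormal, integral_stdComplexNormal]
  set γ := gaussianReal 0 (1 / 2)
  have hneg : MeasurePreserving (fun x : ℝ => -x) γ γ :=
    ⟨measurable_neg, by simp [γ, gaussianReal_map_neg]⟩
  -- Multiplication by `i` swaps the two i.i.d. coordinates and flips the sign of one, which is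
  -- harmless because the real law is symmetric.
  have hrot : MeasurePreserving (fun q : ℝ × ℝ => (-q.2, q.1)) (γ.prod γ) (γ.prod γ) :=
    (hneg.prod (MeasurePreserving.id γ)).comp Measure.measurePreserving_swap
  have hemb : MeasurableEmbedding (fun q : ℝ × ℝ => (-q.2, q.1)) :=
    ((MeasurableEquiv.prodCongr (MeasurableEquiv.neg ℝ) (MeasurableEquiv.refl ℝ)).measurableEmbedding).comp
      MeasurableEquiv.prodComm.measurableEmbedding
  rw [← hrot.integral_comp hemb (fun q => f ⟨q.1, q.2⟩)]
  refine integral_congr_ae (.of_forall fun q => ?_)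
  have : Complex.I * (⟨q.1, q.2⟩ : ℂ) = ⟨-q.2, q.1⟩ := by apply Complex.ext <;> simp
  simp only [this]

/-- The mixed moments of the standard complex normal law, up to degree `2` in each of `z`, `z̄`. -/
theorem moment_stdComplexNormal {n m : ℕ} (hn : n ≤ 2) (hm : m ≤ 2) :
    ∫ z, z ^ n * conj z ^ m ∂stdComplexNormal = if n = m then (n.factorial : ℂ) else 0 := by
  split_ifs with h
  · subst h
    obtain ⟨-, h2, h4⟩ := moments_gaussianReal_half
    -- A non-integrable function has Bochner integral 0, so a nonzero moment already proves
    -- integrability.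
    have i2 : Integrable (fun x : ℝ => x ^ 2) (gaussianReal 0 (1 / 2)) := by
      by_contra hc
      rw [integral_undef hc] at h2; norm_num at h2
    have i4 : Integrable (fun x : ℝ => x ^ 4) (gaussianReal 0 (1 / 2)) := by
      by_contra hc
      rw [integral_undef hc] at h4; norm_num at h4
    have a2 := i2.comp_fst (gaussianReal 0 (1 / 2))
    have b2 := i2.comp_snd (gaussianReal 0 (1 / 2))
    have a4 := i4.comp_fst (gaussianReal 0 (1 / 2))
    have b4 := i4.comp_snd (gaussianReal 0 (1 / 2))
    have c22 := i2.mul_prod i2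
    rw [integral_stdComplexNormal]
    interval_cases n
    · simp
    · have : ∀ q : ℝ × ℝ, (⟨q.1, q.2⟩ : ℂ) ^ 1 * conj (⟨q.1, q.2⟩ : ℂ) ^ 1
          = ((q.1 ^ 2 + q.2 ^ 2 : ℝ) : ℂ) := by
        intro q
        rw [pow_one, pow_one, Complex.mul_conj, Complex.normSq_mk, pow_two, pow_two]
      simp only [this]
      rw [integral_complex_ofReal, integral_add a2 b2, integral_fun_fst (fun x : ℝ => x ^ 2),
        integral_fun_snd (fun x : ℝ => x ^ 2), h2]
      norm_num
    · have : ∀ q : ℝ × ℝ, (⟨q.1, q.2⟩ : ℂ) ^ 2 * conj (⟨q.1, q.2⟩ : ℂ) ^ 2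
          = ((q.1 ^ 4 + q.2 ^ 4 + 2 * (q.1 ^ 2 * q.2 ^ 2) : ℝ) : ℂ) := by
        intro q
        rw [← mul_pow, Complex.mul_conj, Complex.normSq_mk, ← Complex.ofReal_pow]
        congr 1; ring
      simp only [this]
      have ab : Integrable (fun q : ℝ × ℝ => q.1 ^ 4 + q.2 ^ 4)
        ((gaussianReal 0 (1 / 2)).prod (gaussianReal 0 (1 / 2))) := a4.add b4
      rw [integral_complex_ofReal, integral_add ab (c22.const_mul 2), integral_add a4 b4,
        integral_const_mul, integral_prod_mul (fun x : ℝ => x ^ 2) (fun x : ℝ => x ^ 2),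
        integral_fun_fst (fun x : ℝ => x ^ 4), integral_fun_snd (fun x : ℝ => x ^ 4), h2, h4]
      norm_num [Nat.factorial]
  -- Rotation by `i` multiplies the moment by `i ^ (n - m)`, which differs from 1 because `0 < |n -
  -- m| ≤ 2`; hence the moment vanishes.
  · have h1 := integral_stdComplexNormal_rotate (fun z => z ^ n * conj z ^ m)
    have h2 : ∀ z : ℂ, (Complex.I * z) ^ n * conj (Complex.I * z) ^ m
        = (Complex.I ^ n * (-Complex.I) ^ m) * (z ^ n * conj z ^ m) := by
      intro z; simp only [map_mul, Complex.conj_I]; ring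
    simp only [h2] at h1
    rw [integral_const_mul] at h1
    have h3 : Complex.I ^ n * (-Complex.I) ^ m - 1 ≠ 0 := by
      interval_cases n <;> interval_cases m <;> first | (exact absurd rfl h) | skip
      all_goals
        intro hc
        have hr := congrArg Complex.re hc
        simp [pow_succ] at hr
        try norm_num at hr
    have h4 : (Complex.I ^ n * (-Complex.I) ^ m - 1) * ∫ z, z ^ n * conj z ^ m ∂stdComplexNormal
        = 0 := by
      rw [sub_mul, h1]; ring
    exact (mul_eq_zero.mp h4).resolve_left h3

end OneDimensional

/-! ### Wick's formula for affine forms in independent standard Gaussians. -/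

section Wick

instance isProbabilityMeasure_stdComplexNormalVec (N : ℕ) :
    IsProbabilityMeasure (stdComplexNormalVec N) := by
  unfold stdComplexNormalVec; infer_instance

variable {ι : Type*} [Fintype ι] {N : ℕ}

/-- The law of a family of independent standard complex Gaussian vectors. -/
abbrev stdFamily (ι : Type*) [Fintype ι] (N : ℕ) : Measure (ι → Fin N → ℂ) :=
  Measure.pi (fun _ => stdComplexNormalVec N)

theorem integrable_monomial (n m : ι × Fin N → ℕ) :
    Integrable (fun z : ι → Fin N → ℂ => ∏ j : ι × Fin N, z j.1 j.2 ^ n j * conj (z j.1 j.2) ^ m j)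
      (stdFamily ι N) := by
  simp only [Fintype.prod_prod_type]
  exact Integrable.fintype_prod (f := fun a (w : Fin N → ℂ) =>
    ∏ i, w i ^ n (a, i) * conj (w i) ^ m (a, i)) fun a =>
      Integrable.fintype_prod (f := fun i (w : ℂ) => w ^ n (a, i) * conj w ^ m (a, i))
        fun i => integrable_stdComplexNormal _ _

theorem integral_monomial (n m : ι × Fin N → ℕ) :
    ∫ z : ι → Fin N → ℂ, ∏ j : ι × Fin N, z j.1 j.2 ^ n j * conj (z j.1 j.2) ^ m j ∂(stdFamily ι N)
      = ∏ j, ∫ w, w ^ n j * conj w ^ m j ∂stdComplexNormal := by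
  simp only [Fintype.prod_prod_type]
  rw [integral_fintype_prod_eq_prod (fun a (w : Fin N → ℂ) =>
    ∏ i, w i ^ n (a, i) * conj (w i) ^ m (a, i))]
  refine Finset.prod_congr rfl fun a _ => ?_
  exact integral_fintype_prod_eq_prod (fun i (w : ℂ) => w ^ n (a, i) * conj w ^ m (a, i))

/-- The coordinates of a family of vectors, together with the constant `1`. -/
def bordered (z : ι → Fin N → ℂ) (o : Option (ι × Fin N)) : ℂ := o.elim 1 fun j => z j.1 j.2


/-- The linear form with coefficients `c` in the constant `1` and the coordinates. -/
def linForm (c : Option (ι × Fin N) → ℂ) (z : ι → Fin N → ℂ) : ℂ := ∑ o, c o * bordered z o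

theorem linForm_mul_eq_sum (a b c d : Option (ι × Fin N) → ℂ) (z : ι → Fin N → ℂ) :
    linForm a z * conj (linForm b z) * linForm c z * conj (linForm d z)
      = ∑ i, ∑ j, ∑ k, ∑ l, (a i * conj (b j) * c k * conj (d l))
        * (bordered z i * conj (bordered z j) * bordered z k * conj (bordered z l)) := by
  have h : ∀ i j k l, (a i * conj (b j) * c k * conj (d l))
        * (bordered z i * conj (bordered z j) * bordered z k * conj (bordered z l))
      = (a i * bordered z i) * (conj (b j) * conj (bordered z j)) * (c k * bordered z k)
        * (conj (d l) * conj (bordered z l)) := fun i j k l => by ring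
  simp only [h, ← Finset.mul_sum, ← Finset.sum_mul]
  simp only [linForm, map_sum, map_mul]

variable [DecidableEq ι]

theorem bordered_eq_prod (z : ι → Fin N → ℂ) (o : Option (ι × Fin N)) :
    bordered z o = ∏ j : ι × Fin N, z j.1 j.2 ^ (if o = some j then 1 else 0) := by
  cases o with
  | none => simp [bordered]
  | some j => simp [bordered]

/-- The moment of degree `(2, 2)` as an integral over a monomial. -/
theorem bordered_mul_eq_prod (z : ι → Fin N → ℂ) (a b c d : Option (ι × Fin N)) :
    bordered z a * conj (bordered z b) * bordered z c * conj (bordered z d)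
      = ∏ j : ι × Fin N, z j.1 j.2 ^ ((if a = some j then 1 else 0) + (if c = some j then 1 else 0))
        * conj (z j.1 j.2) ^ ((if b = some j then 1 else 0) + (if d = some j then 1 else 0)) := by
  simp only [bordered_eq_prod, map_prod, map_pow, ← Finset.prod_mul_distrib]
  exact Finset.prod_congr rfl fun j _ => by ring

theorem integrable_bordered (a b c d : Option (ι × Fin N)) :
    Integrable (fun z => bordered z a * conj (bordered z b) * bordered z c * conj (bordered z d))
      (stdFamily ι N) := by
  simp only [bordered_mul_eq_prod]
  exact integrable_monomial _ _

/-- The constant 1 obeys the same pairing rule as a Gaussian coordinate, with one exception: when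
all four factors are constant, the two pairings count 2 while the moment is 1. The last term
corrects this, so affine forms need no separate treatment of their means. -/
theorem integral_bordered (a b c d : Option (ι × Fin N)) :
    ∫ z, bordered z a * conj (bordered z b) * bordered z c * conj (bordered z d) ∂(stdFamily ι N)
      = (if a = b then 1 else 0) * (if c = d then 1 else 0)
        + (if a = d then 1 else 0) * (if c = b then 1 else 0)
        - (if a = none then 1 else 0) * (if b = none then 1 else 0)
          * (if c = none then 1 else 0) * (if d = none then 1 else 0) := by
  simp only [bordered_mul_eq_prod]
  rw [integral_monomial]
  have hle (x y : Option (ι × Fin N)) (j) :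
      (if x = some j then 1 else 0) + (if y = some j then 1 else 0) ≤ 2 := by
    split_ifs <;> simp
  simp only [moment_stdComplexNormal (hle _ _ _) (hle _ _ _)]
  -- The condition says that the multisets `{a, c}` and `{b, d}` of plain and conjugated factors
  -- coincide.
  by_cases hmatch : (a = b ∧ c = d) ∨ (a = d ∧ c = b)
  · have hprod (x y : Option (ι × Fin N)) :
        ∏ j, ((((if x = some j then 1 else 0) + (if y = some j then 1 else 0) : ℕ).factorial : ℕ) : ℂ)
          = if x = y ∧ x ≠ none then 2 else 1 := by
      split_ifs with h
      · obtain ⟨rfl, h⟩ := h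
        obtain ⟨j, rfl⟩ := Option.ne_none_iff_exists'.mp h
        rw [Finset.prod_eq_single j]
        · simp
        · intro i _ hi
          simp [Ne.symm hi]
        · simp
      · refine Finset.prod_eq_one fun j _ => ?_
        have : ¬ (x = some j ∧ y = some j) := by
          rintro ⟨rfl, rfl⟩; simp at h
        split_ifs <;> simp_all
    rcases hmatch with ⟨rfl, rfl⟩ | ⟨rfl, rfl⟩
    · simp only [if_true, hprod]
      cases a <;> cases c <;> simp
      all_goals split_ifs <;> grind
    · simp only [add_comm (if c = some _ then 1 else 0), if_true, hprod]
      cases a <;> cases c <;> simp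
      all_goals split_ifs <;> grind
  -- Both multisets have two elements, so they cannot differ in the multiplicity of `none` alone.
  -- Some genuine coordinate then has unequal exponents, and its moment is 0.
  · have hj : ∃ j, (if a = some j then 1 else 0) + (if c = some j then 1 else 0)
        ≠ (if b = some j then 1 else 0) + (if d = some j then 1 else 0) := by
      by_contra! hc
      have hc' (o : Option (ι × Fin N)) (ho : o ≠ none) :
          (if a = o then 1 else 0) + (if c = o then 1 else 0)
            = (if b = o then 1 else 0) + (if d = o then 1 else 0) := by
        obtain ⟨j, rfl⟩ := Option.ne_none_iff_exists'.mp ho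
        exact hc j
      have ha := hc' a
      have hb := hc' b
      have hd := hc' d
      have hcc := hc' c
      clear hc hc' hle
      by_cases a = none <;> by_cases b = none <;> by_cases c = none <;> by_cases d = none <;> grind
    obtain ⟨j, hj⟩ := hj
    rw [Finset.prod_eq_zero (Finset.mem_univ j) (if_neg hj)]
    clear hj hle
    have h1 : ¬ (a = b ∧ c = d) := fun h => hmatch (.inl h)
    have h2 : ¬ (a = d ∧ c = b) := fun h => hmatch (.inr h)
    have h3 : ¬ (((a = none ∧ b = none) ∧ c = none) ∧ d = none) := by
      rintro ⟨⟨⟨rfl, rfl⟩, rfl⟩, rfl⟩; simp at h1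
    simp only [mul_ite, mul_one, mul_zero, ← ite_and]
    grind

theorem integrable_linForm (a b c d : Option (ι × Fin N) → ℂ) :
    Integrable (fun z => linForm a z * conj (linForm b z) * linForm c z * conj (linForm d z))
      (stdFamily ι N) := by
  simp only [linForm_mul_eq_sum]
  exact integrable_finsetSum _ fun i _ => integrable_finsetSum _ fun j _ =>
    integrable_finsetSum _ fun k _ => integrable_finsetSum _ fun l _ =>
      (integrable_bordered i j k l).const_mul _

/-- **Wick's formula** for four affine forms in independent standard complex Gaussians. -/
theorem integral_linForm (a b c d : Option (ι × Fin N) → ℂ) :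
    ∫ z, linForm a z * conj (linForm b z) * linForm c z * conj (linForm d z) ∂(stdFamily ι N)
      = (∑ o, a o * conj (b o)) * (∑ o, c o * conj (d o))
        + (∑ o, a o * conj (d o)) * (∑ o, c o * conj (b o))
        - a none * conj (b none) * c none * conj (d none) := by
  have hi (i j k l) := (integrable_bordered (N := N) (ι := ι) i j k l).const_mul
    (a i * conj (b j) * c k * conj (d l))
  have hl (i j k) := integrable_finsetSum (μ := stdFamily ι N) Finset.univ
    fun l (_ : l ∈ Finset.univ) => hi i j k l
  have hk (i j) := integrable_finsetSum (μ := stdFamily ι N) Finset.univ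
    fun k (_ : k ∈ Finset.univ) => hl i j k
  have hj (i) := integrable_finsetSum (μ := stdFamily ι N) Finset.univ
    fun j (_ : j ∈ Finset.univ) => hk i j
  simp only [linForm_mul_eq_sum]
  rw [integral_finsetSum _ fun i _ => hj i]
  simp only [integral_finsetSum _ fun j _ => hk _ j, integral_finsetSum _ fun k _ => hl _ _ k,
    integral_finsetSum _ fun l _ => hi _ _ _ l, integral_const_mul, integral_bordered]
  simp only [mul_add, mul_sub, Finset.sum_add_distrib, Finset.sum_sub_distrib]
  congr 1
  · congr 1
    · simp [Finset.sum_mul_sum, mul_assoc, -Fintype.sum_option]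
    -- The crossed pairing factorizes once the summand is regrouped by `(i, l)` and `(k, j)`.
    · have : ∀ i j k l, a i * conj (b j) * c k * conj (d l)
          * ((if i = l then 1 else 0) * (if k = j then 1 else 0))
          = (a i * conj (d l) * if i = l then 1 else 0)
            * (c k * conj (b j) * if k = j then 1 else 0) := fun i j k l => by ring
      simp only [this]
      simp [Finset.sum_mul_sum, -Fintype.sum_option]
  · simp

end Wick

/-! ### Moments of affine images of independent Gaussian vectors. -/

section Affine

variable {ι : Type*} [Fintype ι] {N : ℕ}

/-- An affine map from families of vectors of `ℂ^N` to `ℂ^N`: a constant and one matrix per member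
of the family. -/
abbrev AffineVec (ι : Type*) (N : ℕ) := (Fin N → ℂ) × (ι → Matrix (Fin N) (Fin N) ℂ)

namespace AffineVec

/-- The value of an affine map. -/
def eval (U : AffineVec ι N) (x : ι → Fin N → ℂ) : Fin N → ℂ := U.1 + ∑ a, U.2 a *ᵥ x a

/-- The cross-covariance matrix of two affine images of independent vectors with covariance
matrices `R`. -/
def cov (R : ι → Matrix (Fin N) (Fin N) ℂ) (U V : AffineVec ι N) : Matrix (Fin N) (Fin N) ℂ :=
  ∑ a, U.2 a * R a * (V.2 a)ᴴ

/-- The second cross-moment matrix of two affine images of independent vectors with covariance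
matrices `R`. -/
def moment (R : ι → Matrix (Fin N) (Fin N) ℂ) (U V : AffineVec ι N) :
    Matrix (Fin N) (Fin N) ℂ :=
  vecMulVec U.1 (star V.1) + cov R U V

theorem conjTranspose_moment {R : ι → Matrix (Fin N) (Fin N) ℂ} (hR : ∀ a, (R a)ᴴ = R a)
    (U V : AffineVec ι N) : (moment R U V)ᴴ = moment R V U := by
  simp [moment, cov, conjTranspose_sum, conjTranspose_mul, hR, Matrix.mul_assoc]

/-- The coefficients of a coordinate of an affine map, after the substitution `x a = L a *ᵥ z a`. -/
def coeff (U : AffineVec ι N) (L : ι → Matrix (Fin N) (Fin N) ℂ) (i : Fin N)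
    (o : Option (ι × Fin N)) : ℂ :=
  o.elim (U.1 i) fun j => (U.2 j.1 * L j.1) i j.2

theorem eval_eq_linForm (U : AffineVec ι N) (L : ι → Matrix (Fin N) (Fin N) ℂ) (i : Fin N)
    (z : ι → Fin N → ℂ) : U.eval (fun a => L a *ᵥ z a) i = linForm (U.coeff L i) z := by
  simp only [eval, mulVec_mulVec, Pi.add_apply, Finset.sum_apply, linForm, Fintype.sum_option,
    coeff, bordered, Option.elim, Fintype.sum_prod_type, mul_one]
  rfl

/-- The constant coefficient contributes the product of the means and the others the covariance. The
factors `L` enter only through `L Lᴴ`, so the choice of factorization drops out. -/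
theorem sum_coeff_mul (U V : AffineVec ι N) (L : ι → Matrix (Fin N) (Fin N) ℂ) (i j : Fin N) :
    ∑ o, U.coeff L i o * conj (V.coeff L j o) = moment (fun a => L a * (L a)ᴴ) U V i j := by
  have h (a) : U.2 a * (L a * (L a)ᴴ) * (V.2 a)ᴴ = (U.2 a * L a) * (V.2 a * L a)ᴴ := by
    rw [conjTranspose_mul]; simp only [Matrix.mul_assoc]
  simp only [Fintype.sum_option, coeff, Option.elim, Fintype.sum_prod_type, moment, cov, h,
    Matrix.add_apply, Matrix.sum_apply, vecMulVec_apply]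
  simp only [Matrix.mul_apply (M := U.2 _ * L _)]
  rfl

theorem measurable_eval (U : AffineVec ι N) : Measurable U.eval := by
  unfold eval
  refine Continuous.measurable ?_
  fun_prop

end AffineVec

variable {Ω : Type*} [MeasurableSpace Ω] {ν : Measure Ω} [IsProbabilityMeasure ν]
  {X : ι → Ω → Fin N → ℂ} {R : ι → Matrix (Fin N) (Fin N) ℂ}

/-- Independence makes the joint law the product of the marginals, and a product of linear images is
the image of the product. All moments can thus be computed for the standard family. -/
theorem exists_map_eq_map_stdFamily (hX : ∀ a, HasComplexNormalLaw ν (X a) 0 (R a))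
    (hind : iIndepFun X ν) :
    AEMeasurable (fun ω a => X a ω) ν ∧ ∃ L : ι → Matrix (Fin N) (Fin N) ℂ,
      (fun a => L a * (L a)ᴴ) = R ∧
      ν.map (fun ω a => X a ω) = (stdFamily ι N).map (fun z a => L a *ᵥ z a) := by
  choose hm L hL hlaw using hX
  refine ⟨aemeasurable_pi_lambda _ hm, L, funext hL, ?_⟩
  rw [(iIndepFun_iff_map_fun_eq_pi_map hm).mp hind]
  simp only [hlaw, zero_add]
  have hmeas (a : ι) : Measurable (fun z : Fin N → ℂ => L a *ᵥ z) :=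
    Continuous.measurable (by fun_prop)
  have hprob (a : ι) : IsProbabilityMeasure ((stdComplexNormalVec N).map (fun z => L a *ᵥ z)) :=
    Measure.isProbabilityMeasure_map (hmeas a).aemeasurable
  exact (Measure.pi_map_pi fun a => (hmeas a).aemeasurable).symm

omit [Fintype ι] [IsProbabilityMeasure ν] in
theorem hermitian_of_hasComplexNormalLaw (hX : ∀ a, HasComplexNormalLaw ν (X a) 0 (R a)) (a : ι) :
    (R a)ᴴ = R a := by
  obtain ⟨-, L, hL, -⟩ := hX a
  rw [← hL]; simp

variable [DecidableEq ι]

/-- This is Wick's formula transported along the joint law; the pairing sums become second-moment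
matrices. -/
theorem integrable_integral_eval_four (hX : ∀ a, HasComplexNormalLaw ν (X a) 0 (R a))
    (hind : iIndepFun X ν) (U₁ U₂ U₃ U₄ : AffineVec ι N) (i₁ i₂ i₃ i₄ : Fin N) :
    Integrable (fun ω => U₁.eval (X · ω) i₁ * conj (U₂.eval (X · ω) i₂) * U₃.eval (X · ω) i₃
      * conj (U₄.eval (X · ω) i₄)) ν ∧
    ∫ ω, U₁.eval (X · ω) i₁ * conj (U₂.eval (X · ω) i₂) * U₃.eval (X · ω) i₃
      * conj (U₄.eval (X · ω) i₄) ∂ν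
      = AffineVec.moment R U₁ U₂ i₁ i₂ * AffineVec.moment R U₃ U₄ i₃ i₄
        + AffineVec.moment R U₁ U₄ i₁ i₄ * AffineVec.moment R U₃ U₂ i₃ i₂
        - U₁.1 i₁ * conj (U₂.1 i₂) * U₃.1 i₃ * conj (U₄.1 i₄) := by
  obtain ⟨hm, L, rfl, hmap⟩ := exists_map_eq_map_stdFamily hX hind
  have hL : Measurable (fun (z : ι → Fin N → ℂ) a => L a *ᵥ z a) :=
    Continuous.measurable (by fun_prop)
  have hU (U : AffineVec ι N) (i : Fin N) : Measurable fun x => U.eval x i :=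
    (measurable_pi_apply i).comp U.measurable_eval
  let F : (ι → Fin N → ℂ) → ℂ := fun x => U₁.eval x i₁ * conj (U₂.eval x i₂) * U₃.eval x i₃
      * conj (U₄.eval x i₄)
  have hF : Measurable F := by
    have h2 := Complex.continuous_conj.measurable.comp (hU U₂ i₂)
    have h4 := Complex.continuous_conj.measurable.comp (hU U₄ i₄)
    exact (((hU U₁ i₁).mul h2).mul (hU U₃ i₃)).mul h4
  constructor
  · have h : Integrable F (ν.map (fun ω a => X a ω)) := by
      rw [hmap, integrable_map_measure hF.aestronglyMeasurable hL.aemeasurable]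
      simp only [F, Function.comp_def, AffineVec.eval_eq_linForm]
      exact integrable_linForm _ _ _ _
    exact (integrable_map_measure hF.aestronglyMeasurable hm).mp h
  · calc _ = ∫ x, F x ∂(ν.map (fun ω a => X a ω)) :=
          (integral_map hm hF.aestronglyMeasurable).symm
      _ = _ := by
        rw [hmap, integral_map hL.aemeasurable hF.aestronglyMeasurable]
        simp only [F, AffineVec.eval_eq_linForm]
        rw [integral_linForm]
        simp only [AffineVec.sum_coeff_mul]
        rfl

theorem integrable_integral_eval_two (hX : ∀ a, HasComplexNormalLaw ν (X a) 0 (R a))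
    (hind : iIndepFun X ν) (U V : AffineVec ι N) (i j : Fin N) :
    Integrable (fun ω => U.eval (X · ω) i * conj (V.eval (X · ω) j)) ν ∧
    ∫ ω, U.eval (X · ω) i * conj (V.eval (X · ω) j) ∂ν = AffineVec.moment R U V i j := by
  -- With the last two forms constantly 1, the crossed pairing is the product of the means and
  -- cancels the correction term.
  have h := integrable_integral_eval_four hX hind U V (1, 0) (1, 0) i j i i
  have h1 (x : ι → Fin N → ℂ) : AffineVec.eval ((1, 0) : AffineVec ι N) x i = 1 := by
    simp [AffineVec.eval]
  simp only [h1, map_one, mul_one] at h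
  refine ⟨h.1, h.2.trans ?_⟩
  simp [AffineVec.moment, AffineVec.cov, vecMulVec_apply]

/-- The mean of a Hermitian product of affine images. -/
theorem integrable_integral_dotProduct (hX : ∀ a, HasComplexNormalLaw ν (X a) 0 (R a))
    (hind : iIndepFun X ν) (S T : AffineVec ι N) :
    Integrable (fun ω => star (S.eval (X · ω)) ⬝ᵥ T.eval (X · ω)) ν ∧
    ∫ ω, star (S.eval (X · ω)) ⬝ᵥ T.eval (X · ω) ∂ν = trace (AffineVec.moment R T S) := by
  have h (i : Fin N) := integrable_integral_eval_two hX hind T S i i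
  have e (ω) : star (S.eval (X · ω)) ⬝ᵥ T.eval (X · ω)
      = ∑ i, T.eval (X · ω) i * conj (S.eval (X · ω) i) :=
    Finset.sum_congr rfl fun i _ => mul_comm _ _
  simp only [e]
  refine ⟨integrable_finsetSum _ fun i _ => (h i).1, ?_⟩
  rw [integral_finsetSum _ fun i _ => (h i).1]
  exact Finset.sum_congr rfl fun i _ => (h i).2

variable {κ : Type*} [Fintype κ]

/-- The mean square of a sum of Hermitian products of affine images. -/
theorem integrable_integral_norm_sum_dotProduct (hX : ∀ a, HasComplexNormalLaw ν (X a) 0 (R a))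
    (hind : iIndepFun X ν) (S T : κ → AffineVec ι N) :
    Integrable (fun ω => ‖∑ m, star ((S m).eval (X · ω)) ⬝ᵥ (T m).eval (X · ω)‖ ^ 2) ν ∧
    ((∫ ω, ‖∑ m, star ((S m).eval (X · ω)) ⬝ᵥ (T m).eval (X · ω)‖ ^ 2 ∂ν : ℝ) : ℂ)
      = ((‖∑ m, trace (AffineVec.moment R (T m) (S m))‖ ^ 2 : ℝ) : ℂ)
        + ∑ m, ∑ n, (trace (AffineVec.moment R (T m) (T n) * AffineVec.moment R (S n) (S m))
          - trace (vecMulVec (T m).1 (star (T n).1) * vecMulVec (S n).1 (star (S m).1))) := by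
  have h (m i n j) := integrable_integral_eval_four hX hind (T m) (S m) (S n) (T n) i i j j
  -- The factors are ordered as `T S̄ S T̄`: the first pairing rebuilds the mean gains, the second
  -- pairs `T` with `T` and `S` with `S`.
  have e (ω) : ((‖∑ m, star ((S m).eval (X · ω)) ⬝ᵥ (T m).eval (X · ω)‖ ^ 2 : ℝ) : ℂ)
      = ∑ m, ∑ i, ∑ n, ∑ j, (T m).eval (X · ω) i * conj ((S m).eval (X · ω) i)
          * (S n).eval (X · ω) j * conj ((T n).eval (X · ω) j) := by
    rw [Complex.ofReal_pow, ← Complex.mul_conj']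
    have p (m i n j) : (T m).eval (X · ω) i * conj ((S m).eval (X · ω) i)
        * (S n).eval (X · ω) j * conj ((T n).eval (X · ω) j)
        = (conj ((S m).eval (X · ω) i) * (T m).eval (X · ω) i)
          * ((S n).eval (X · ω) j * conj ((T n).eval (X · ω) j)) := by ring
    simp only [p, ← Finset.mul_sum, ← Finset.sum_mul]
    simp only [map_sum, dotProduct, map_mul, Pi.star_apply, Complex.star_def, Complex.conj_conj]
  have hint : Integrable (fun ω =>
      ((‖∑ m, star ((S m).eval (X · ω)) ⬝ᵥ (T m).eval (X · ω)‖ ^ 2 : ℝ) : ℂ)) ν := by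
    simp only [e]
    exact integrable_finsetSum _ fun m _ => integrable_finsetSum _ fun i _ =>
      integrable_finsetSum _ fun n _ => integrable_finsetSum _ fun j _ => (h m i n j).1
  refine ⟨by simpa only [RCLike.re_to_complex, Complex.ofReal_re] using hint.re, ?_⟩
  rw [← integral_complex_ofReal]
  simp only [e]
  rw [integral_finsetSum _ fun m _ => integrable_finsetSum _ fun i _ =>
      integrable_finsetSum _ fun n _ => integrable_finsetSum _ fun j _ => (h m i n j).1]
  simp only [integral_finsetSum _ fun i _ => integrable_finsetSum _ fun n _ =>
    integrable_finsetSum _ fun j _ => (h _ i n j).1,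
    integral_finsetSum _ fun n _ => integrable_finsetSum _ fun j _ => (h _ _ n j).1,
    integral_finsetSum _ fun j _ => (h _ _ _ j).1, (h _ _ _ _).2]
  have hconj (n) : ∑ j, AffineVec.moment R (S n) (T n) j j
      = conj (trace (AffineVec.moment R (T n) (S n))) := by
    rw [← AffineVec.conjTranspose_moment (hermitian_of_hasComplexNormalLaw hX) (T n) (S n)]
    simp [trace]
  simp only [Finset.sum_add_distrib, Finset.sum_sub_distrib, ← Finset.mul_sum, hconj,
    ← Finset.sum_mul]
  rw [Complex.ofReal_pow, ← Complex.mul_conj', map_sum, add_sub_assoc]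
  congr 2
  · refine Finset.sum_congr rfl fun m _ => ?_
    rw [Finset.sum_comm]
    simp only [trace, diag_apply, Matrix.mul_apply]
  · refine Finset.sum_congr rfl fun m _ => ?_
    rw [Finset.sum_comm]
    simp only [trace, diag_apply, Matrix.mul_apply, vecMulVec_apply, Pi.star_apply,
      Complex.star_def]
    refine Finset.sum_congr rfl fun n _ => Finset.sum_congr rfl fun i _ =>
      Finset.sum_congr rfl fun j _ => by ring

/-- The mean square of a sum of Hermitian products of affine images that are uncorrelated for
distinct indices. -/
theorem integral_norm_sum_dotProduct_of_uncorrelated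
    [DecidableEq κ] (hX : ∀ a, HasComplexNormalLaw ν (X a) 0 (R a)) (hind : iIndepFun X ν)
    (S T : κ → AffineVec ι N) (CS CT : κ → Matrix (Fin N) (Fin N) ℂ)
    (hS : ∀ m n, AffineVec.cov R (S m) (S n) = if m = n then CS m else 0)
    (hT : ∀ m n, AffineVec.cov R (T m) (T n) = if m = n then CT m else 0) :
    ((∫ ω, ‖∑ m, star ((S m).eval (X · ω)) ⬝ᵥ (T m).eval (X · ω)‖ ^ 2 ∂ν : ℝ) : ℂ)
      = ((‖∑ m, trace (AffineVec.moment R (T m) (S m))‖ ^ 2 : ℝ) : ℂ)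
        + ∑ m, (trace (CT m * CS m) + trace (CT m * vecMulVec (S m).1 (star (S m).1))
          + trace (vecMulVec (T m).1 (star (T m).1) * CS m)) := by
  rw [(integrable_integral_norm_sum_dotProduct hX hind S T).2]
  congr 1
  refine Finset.sum_congr rfl fun m _ => ?_
  -- Off the diagonal both moment matrices reduce to products of means, which the subtracted trace
  -- cancels exactly.
  rw [Finset.sum_eq_single m]
  · simp only [AffineVec.moment, hS, hT, if_true, Matrix.add_mul, Matrix.mul_add, trace_add]
    ring
  · intro n _ hn
    simp [AffineVec.moment, hS, hT, hn, hn.symm]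
  · simp

end Affine

/-! ### Precoders and channels as affine maps, and their covariances. -/

namespace Network

variable {M K N : ℕ} (S : Network M K N)

/-- The index set of the independent vectors: the channels, and the pilot noise of one UE. -/
abbrev NoiseIndex (M K : ℕ) := (Fin M × Fin K) ⊕ Fin M

/-- The covariance matrices of the channels and of the pilot noise. -/
def noiseCov : NoiseIndex M K → Matrix (Fin N) (Fin N) ℂ :=
  Sum.elim (fun i => S.R i.1 i.2)
    (fun _ => ((S.τp * S.noise : ℝ) : ℂ) • (1 : Matrix (Fin N) (Fin N) ℂ))

/-- The scaled precoder `e W_{ml} ĝ_{ml}` as an affine map of the channels and the noise. -/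
def precoderVec (e : ℂ) (m : Fin M) (l : Fin K) : AffineVec (NoiseIndex M K) N :=
  (e • S.W m l *ᵥ S.gbar m l,
    Sum.elim
      (fun i => if i.1 = m ∧ i.2 ∈ S.P l then
        ((Real.sqrt (S.p i.2) * S.τp : ℝ) : ℂ) • e • (S.W m l * S.A m l) else 0)
      (fun n => if n = m then e • (S.W m l * S.A m l) else 0))

/-- The channel `g_{mk}` as an affine map. -/
def channelVec (m : Fin M) (k : Fin K) : AffineVec (NoiseIndex M K) N :=
  (S.gbar m k, Pi.single (Sum.inl (m, k)) 1)

section Eval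

variable {Ω : Type*} (gcheck nP : Fin M → Fin K → Ω → Fin N → ℂ)

/-- The channels and the pilot noise of UE `l`. -/
def noiseFamily (l : Fin K) : NoiseIndex M K → Ω → Fin N → ℂ :=
  Sum.elim (fun i => gcheck i.1 i.2) (fun m => nP m l)

/-- Subtracting `ȳ` removes the line-of-sight parts, leaving the zero-mean channels of the co-pilot
UEs at AP `m` and the noise of UE `l`. -/
theorem eval_precoderVec (e : ℂ) (m : Fin M) (l : Fin K) (ω : Ω) :
    (S.precoderVec e m l).eval (noiseFamily gcheck nP l · ω) = e • S.fbar gcheck nP m l ω := by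
  have hy : S.y gcheck nP m l ω - S.ybar m l
      = (∑ j ∈ S.P l, ((Real.sqrt (S.p j) * S.τp : ℝ) : ℂ) • gcheck m j ω) + nP m l ω := by
    simp only [y, ybar, g, smul_add, Finset.sum_add_distrib]
    abel
  simp only [AffineVec.eval, precoderVec, fbar, ghat, hy, mulVec_add, mulVec_sum, mulVec_smul,
    mulVec_mulVec, smul_add, Finset.smul_sum, Fintype.sum_sum_type, Sum.elim_inl, Sum.elim_inr,
    noiseFamily, Fintype.sum_prod_type]
  congr 2
  · rw [Finset.sum_eq_single m]
    · simp only [true_and]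
      rw [← Finset.sum_subset (Finset.subset_univ (S.P l))]
      · refine Finset.sum_congr rfl fun j hj => ?_
        rw [if_pos hj, smul_mulVec, smul_mulVec, smul_comm]
      · intro j _ hj
        rw [if_neg hj, zero_mulVec]
    · intro n _ hn
      simp [hn]
    · simp
  · rw [Finset.sum_eq_single m]
    · simp [smul_mulVec]
    · intro n _ hn
      simp [hn]
    · simp

theorem eval_channelVec (m : Fin M) (k l : Fin K) (ω : Ω) :
    (S.channelVec m k).eval (noiseFamily gcheck nP l · ω) = S.g gcheck m k ω := by
  simp only [AffineVec.eval, channelVec, g]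
  rw [Finset.sum_eq_single (Sum.inl (m, k))]
  · simp [noiseFamily]
  · intro a _ ha
    simp [ha]
  · simp

end Eval

/-- Precoders at distinct APs involve disjoint members of the family. At one AP the weights give `∑
p_j τp² Ř_j + τp σ² I = τp Ψ`. -/
theorem cov_precoderVec (e : Fin M → ℝ) (l : Fin K) (m n : Fin M) :
    AffineVec.cov S.noiseCov (S.precoderVec (e m) m l) (S.precoderVec (e n) n l)
      = if m = n then (e m : ℂ) ^ 2 • (S.W m l * S.Rtilde m l * (S.W m l)ᴴ) else 0 := by
  simp only [AffineVec.cov, Fintype.sum_sum_type, precoderVec, noiseCov, Sum.elim_inl,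
    Sum.elim_inr, Fintype.sum_prod_type]
  by_cases h : m = n
  · subst h
    rw [if_pos rfl, Finset.sum_eq_single m, Finset.sum_eq_single m]
    · simp only [true_and, if_true]
      rw [← Finset.sum_subset (Finset.subset_univ (S.P l))]
      · simp only [Rtilde, Psi, Matrix.mul_add, Matrix.add_mul, Matrix.mul_sum, Matrix.sum_mul,
          smul_add, Finset.smul_sum]
        congr 1
        · refine Finset.sum_congr rfl fun j hj => ?_
          have hp : (Real.sqrt (S.p j) : ℂ) ^ 2 = (S.p j : ℂ) := by
            rw [← Complex.ofReal_pow, Real.sq_sqrt (S.p_nonneg j)]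
          rw [if_pos hj]
          simp only [conjTranspose_smul, conjTranspose_mul, Matrix.smul_mul, Matrix.mul_smul,
            smul_smul, Matrix.mul_assoc, Complex.star_def]
          congr 1
          push_cast
          simp only [map_mul, Complex.conj_ofReal, Complex.conj_natCast]
          rw [← hp]
          ring
        · simp only [conjTranspose_smul, conjTranspose_mul, Matrix.smul_mul, Matrix.mul_smul,
            smul_smul, Matrix.mul_assoc, Complex.star_def, Complex.conj_ofReal, Matrix.one_mul]
          congr 1
          push_cast
          ring
      · intro j _ hj
        simp [hj]
    · intro n _ hn
      simp [hn]
    · simp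
    · intro n _ hn
      simp [hn]
    · simp
  · rw [if_neg h, Finset.sum_eq_zero, Finset.sum_eq_zero, add_zero]
    · intro i _
      by_cases him : i = m
      · subst him; simp [h]
      · simp [him]
    · intro i _
      refine Finset.sum_eq_zero fun j _ => ?_
      by_cases him : i = m
      · subst him; simp [h]
      · simp [him]

theorem cov_channelVec (k : Fin K) (m n : Fin M) :
    AffineVec.cov S.noiseCov (S.channelVec m k) (S.channelVec n k)
      = if m = n then S.R m k else 0 := by
  simp only [AffineVec.cov, channelVec]
  rw [Finset.sum_eq_single (Sum.inl (m, k))]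
  · split_ifs with h
    · subst h; simp [noiseCov]
    · simp [h]
  · intro a _ ha
    simp [ha]
  · simp

/-- This is pilot contamination: the channel of UE `k` enters the precoder of UE `l` only through a
shared pilot. -/
theorem cov_channelVec_precoderVec (e : ℝ) (m : Fin M) (k l : Fin K) :
    AffineVec.cov S.noiseCov (S.channelVec m k) (S.precoderVec e m l)
      = if k ∈ S.P l then ((e * (Real.sqrt (S.p k) * S.τp) : ℝ) : ℂ) •
          (S.R m k * (S.A m l)ᴴ * (S.W m l)ᴴ) else 0 := by
  simp only [AffineVec.cov, channelVec]
  rw [Finset.sum_eq_single (Sum.inl (m, k))]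
  · split_ifs with h
    · simp only [precoderVec, noiseCov, Sum.elim_inl, Pi.single_eq_same, h, and_self, if_true,
        Matrix.one_mul, conjTranspose_smul, conjTranspose_mul, Matrix.mul_smul, smul_smul,
        Matrix.mul_assoc, Complex.star_def]
      congr 1
      push_cast
      simp only [map_mul, Complex.conj_ofReal, Complex.conj_natCast]
      ring
    · simp [precoderVec, h]
  · intro a _ ha
    simp [ha]
  · simp

theorem mem_P_comm {k l : Fin K} : k ∈ S.P l ↔ l ∈ S.P k := by
  simp [P, eq_comm]

theorem trace_mul_Gbar (B : Matrix (Fin N) (Fin N) ℂ) (m : Fin M) (k l : Fin K) :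
    trace (B * S.Gbar m k l) = star (S.gbar m l) ⬝ᵥ (B *ᵥ S.gbar m k) := by
  rw [Gbar, mul_vecMulVec, trace_vecMulVec, dotProduct_comm]

theorem conj_trace (B : Matrix (Fin N) (Fin N) ℂ) : conj (trace B) = trace Bᴴ := by
  rw [trace_conjTranspose]; rfl

/-- The mean of the effective gain, in terms of the trace with `Ř Aᴴ`. -/
theorem trace_moment_channelVec_precoderVec (e : ℝ) (m : Fin M) (k l : Fin K) :
    trace (AffineVec.moment S.noiseCov (S.channelVec m k) (S.precoderVec e m l))
      = e * (trace ((S.W m l)ᴴ * S.Gbar m k l) + if k ∈ S.P l then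
          ((Real.sqrt (S.p k) * S.τp : ℝ) : ℂ) * trace ((S.W m l)ᴴ * S.R m k * (S.A m l)ᴴ)
          else 0) := by
  rw [AffineVec.moment, trace_add, cov_channelVec_precoderVec, mul_add]
  congr 1
  · simp only [channelVec, precoderVec, star_smul, Gbar, trace_vecMulVec, mul_vecMulVec,
      dotProduct_smul, star_mulVec, Complex.star_def, Complex.conj_ofReal, smul_eq_mul]
    rw [dotProduct_comm, ← dotProduct_mulVec, dotProduct_comm]
  · split_ifs
    · rw [trace_smul, trace_mul_comm, Matrix.mul_assoc]
      push_cast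
      rw [smul_eq_mul, mul_assoc]
    · simp

end Network

/-! ### Trace identities behind `μ`, `ω` and `λ`. -/

namespace Network

variable {M K N : ℕ} (S : Network M K N)

theorem conjTranspose_Gbar (m : Fin M) (k l : Fin K) : (S.Gbar m k l)ᴴ = S.Gbar m l k := by
  simp [Gbar]

theorem conj_trace_mul_Gbar (m : Fin M) (k l : Fin K) :
    conj (trace (S.W m l * S.Gbar m l k)) = trace ((S.W m l)ᴴ * S.Gbar m k l) := by
  rw [conj_trace, conjTranspose_mul, conjTranspose_Gbar, trace_mul_comm]

/-- Both `Ḡ` factors have rank one, so the scalar `ḡ_kᴴ W ḡ_l` splits off. The first term of `μ` is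
therefore the line-of-sight part of `|λ|²`. -/
theorem trace_mul_Gbar_mul_Gbar (m : Fin M) (k l : Fin K) :
    trace ((S.W m l)ᴴ * S.Gbar m k k * S.W m l * S.Gbar m l l)
      = trace ((S.W m l)ᴴ * S.Gbar m k l) * trace (S.W m l * S.Gbar m l k) := by
  have h : (S.W m l)ᴴ * S.Gbar m k k * S.W m l * S.Gbar m l l
      = trace (S.W m l * S.Gbar m l k) • ((S.W m l)ᴴ * S.Gbar m k l) := by
    rw [trace_mul_Gbar, Matrix.mul_assoc, Matrix.mul_assoc, ← Matrix.mul_smul]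
    congr 1
    rw [Gbar, Gbar, Gbar, mul_vecMulVec, vecMulVec_mul_vecMulVec, vecMulVec_smul]
  rw [h, trace_smul, smul_eq_mul, mul_comm]

variable {S}

theorem conj_trace_mul_A_mul_R (m : Fin M) (k l : Fin K) (hR : (S.R m k)ᴴ = S.R m k) :
    conj (trace (S.W m l * S.A m l * S.R m k))
      = trace ((S.W m l)ᴴ * S.R m k * (S.A m l)ᴴ) := by
  rw [conj_trace, conjTranspose_mul, conjTranspose_mul, hR, ← Matrix.mul_assoc,
    trace_mul_comm, ← Matrix.mul_assoc]

theorem lam_eq (m : Fin M) (k l : Fin K) :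
    S.lam m k l = S.etaBar m l * (trace (S.W m l * S.Gbar m l k) + if l ∈ S.P k then
      ((Real.sqrt (S.p k) * S.τp : ℝ) : ℂ) * trace (S.W m l * S.A m l * S.R m k) else 0) := by
  unfold lam Btilde
  split_ifs
  · rw [Matrix.mul_add, trace_add, Matrix.mul_smul, trace_smul, smul_eq_mul, Matrix.mul_assoc]
  · rw [add_zero]

/-- The mean of the effective gain is the conjugate of `λ_{mkl}`. -/
theorem trace_moment_eq_conj_lam (m : Fin M) (k l : Fin K) (hR : (S.R m k)ᴴ = S.R m k) :
    trace (AffineVec.moment S.noiseCov (S.channelVec m k) (S.precoderVec (S.etaBar m l) m l))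
      = conj (S.lam m k l) := by
  rw [trace_moment_channelVec_precoderVec, lam_eq, map_mul, map_add, conj_trace_mul_Gbar,
    Complex.conj_ofReal]
  simp only [S.mem_P_comm (k := k) (l := l)]
  congr 2
  split_ifs
  · rw [map_mul, conj_trace_mul_A_mul_R m k l hR, Complex.conj_ofReal]
  · rw [map_zero]

theorem trace_moment_self (m : Fin M) (k : Fin K) :
    trace (AffineVec.moment S.noiseCov (S.channelVec m k) (S.precoderVec (S.etaBar m k) m k))
      = S.etaBar m k * trace ((S.W m k)ᴴ * S.Rbar m k) := by
  have hk : k ∈ S.P k := by simp [P]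
  rw [trace_moment_channelVec_precoderVec, if_pos hk, Rbar, Matrix.mul_add, trace_add,
    Matrix.mul_smul, trace_smul, smul_eq_mul, Matrix.mul_assoc]

/-- Expanding `|λ|²` gives the first trace of `μ` and, for a shared pilot, two cross terms and a
square that are exactly `ω`. What remains is the three traces left by the crossed Wick pairing. -/
theorem mu_add_omega_sub_lam (m : Fin M) (k l : Fin K) (hR : (S.R m k)ᴴ = S.R m k) :
    S.mu m k l + (if l ∈ S.P k then S.omega m k l else 0) - ((‖S.lam m k l‖ ^ 2 : ℝ) : ℂ)
      = (S.etaBar m l : ℂ) ^ 2 * trace ((S.W m l)ᴴ * S.R m k * S.W m l * S.Rtilde m l)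
        + (S.etaBar m l : ℂ) ^ 2 * trace ((S.W m l)ᴴ * S.R m k * S.W m l * S.Gbar m l l)
        + (S.etaBar m l : ℂ) ^ 2
          * trace ((S.W m l)ᴴ * S.Gbar m k k * S.W m l * S.Rtilde m l) := by
  have hp : (Real.sqrt (S.p k) : ℂ) ^ 2 = (S.p k : ℂ) := by
    rw [← Complex.ofReal_pow, Real.sq_sqrt (S.p_nonneg k)]
  have hn : ((‖S.lam m k l‖ ^ 2 : ℝ) : ℂ) = S.lam m k l * conj (S.lam m k l) := by
    rw [Complex.ofReal_pow, Complex.mul_conj']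
  have hn' : ((‖trace ((S.W m l)ᴴ * S.R m k * (S.A m l)ᴴ)‖ ^ 2 : ℝ) : ℂ)
      = trace (S.W m l * S.A m l * S.R m k) * trace ((S.W m l)ᴴ * S.R m k * (S.A m l)ᴴ) := by
    rw [← conj_trace_mul_A_mul_R m k l hR, Complex.norm_conj, Complex.ofReal_pow,
      Complex.mul_conj']
  rw [hn, lam_eq, mu, trace_mul_Gbar_mul_Gbar]
  split_ifs
  · rw [map_mul, map_add, map_mul, conj_trace_mul_Gbar, conj_trace_mul_A_mul_R m k l hR,
      Complex.conj_ofReal, Complex.conj_ofReal, omega, hn', ← hp]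
    push_cast
    ring
  · rw [add_zero, add_zero, map_mul, conj_trace_mul_Gbar, Complex.conj_ofReal]
    ring

theorem trace_moment_precoderVec (m : Fin M) (l : Fin K) :
    trace (AffineVec.moment S.noiseCov (S.precoderVec 1 m l) (S.precoderVec 1 m l))
      = S.powerTrace m l := by
  have h := S.cov_precoderVec (fun _ => 1) l m m
  rw [Complex.ofReal_one, if_pos rfl, one_pow, one_smul] at h
  rw [AffineVec.moment, h, trace_add, powerTrace]
  congr 1
  · simp only [precoderVec, one_smul]
    rw [trace_vecMulVec, Matrix.mul_assoc, trace_mul_comm, Gbar, mul_vecMulVec, vecMulVec_mul,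
      trace_vecMulVec, star_mulVec]
  · rw [trace_mul_comm, Matrix.mul_assoc]

/-! ### Expectations under the Rician model. -/

section Model

variable {Ω : Type*} [MeasurableSpace Ω] {ν : Measure Ω} [IsProbabilityMeasure ν]
  {gcheck nP : Fin M → Fin K → Ω → Fin N → ℂ}

omit [IsProbabilityMeasure ν] in
theorem IsRicianModel.law (h : S.IsRicianModel gcheck nP ν) (l : Fin K) (a : NoiseIndex M K) :
    HasComplexNormalLaw ν (noiseFamily gcheck nP l a) 0 (S.noiseCov a) := by
  cases a with
  | inl i => exact h.channel_law i.1 i.2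
  | inr m => exact h.noise_law m l

omit [IsProbabilityMeasure ν] in
theorem IsRicianModel.conjTranspose_R (h : S.IsRicianModel gcheck nP ν) (m : Fin M) (k : Fin K) :
    (S.R m k)ᴴ = S.R m k := hermitian_of_hasComplexNormalLaw
      (X := fun _ : Unit => gcheck m k) (R := fun _ => S.R m k) (fun _ => h.channel_law m k) ()

theorem IsRicianModel.integrable_meanSqPrecoder (h : S.IsRicianModel gcheck nP ν) (m : Fin M)
    (l : Fin K) :
    Integrable (fun ω => ‖WithLp.toLp 2 (S.fbar gcheck nP m l ω)‖ ^ 2) ν ∧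
      ((S.meanSqPrecoder gcheck nP ν m l : ℝ) : ℂ) = S.powerTrace m l := by
  obtain ⟨hi, he⟩ := integrable_integral_dotProduct (h.law l) (h.indep l)
    (S.precoderVec 1 m l) (S.precoderVec 1 m l)
  have e (ω) : star ((S.precoderVec 1 m l).eval (noiseFamily gcheck nP l · ω))
      ⬝ᵥ (S.precoderVec 1 m l).eval (noiseFamily gcheck nP l · ω)
      = ((‖WithLp.toLp 2 (S.fbar gcheck nP m l ω)‖ ^ 2 : ℝ) : ℂ) := by
    rw [eval_precoderVec, one_smul, EuclideanSpace.norm_sq_eq]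
    simp only [dotProduct, Pi.star_apply, Complex.star_def, Complex.conj_mul', Complex.ofReal_sum,
      Complex.ofReal_pow]
  have hi' : Integrable (fun ω =>
      ((‖WithLp.toLp 2 (S.fbar gcheck nP m l ω)‖ ^ 2 : ℝ) : ℂ)) ν := by
    simpa only [e] using hi
  refine ⟨by simpa only [RCLike.re_to_complex, Complex.ofReal_re] using hi'.re, ?_⟩
  rw [← trace_moment_precoderVec, ← he, meanSqPrecoder, ← integral_complex_ofReal]
  exact integral_congr_ae (.of_forall fun ω => (e ω).symm)

/-- A vanishing denominator needs no separate case: both sides use the same convention for division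
by zero. -/
theorem IsRicianModel.eta_eq (h : S.IsRicianModel gcheck nP ν) (m : Fin M) (l : Fin K) :
    S.eta gcheck nP ν m l = S.etaBar m l := by
  rw [eta, etaBar, ← (h.integrable_meanSqPrecoder m l).2, Complex.ofReal_re]

theorem IsRicianModel.gain_eq (h : S.IsRicianModel gcheck nP ν) (m : Fin M) (l k : Fin K) (ω : Ω) :
    S.gain gcheck nP ν m l k ω
      = star ((S.precoderVec (S.etaBar m l) m l).eval (noiseFamily gcheck nP l · ω))
        ⬝ᵥ (S.channelVec m k).eval (noiseFamily gcheck nP l · ω) := by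
  rw [eval_precoderVec, eval_channelVec, gain, f, h.eta_eq]

theorem IsRicianModel.integrable_gain (h : S.IsRicianModel gcheck nP ν) (m : Fin M)
    (l k : Fin K) : Integrable (S.gain gcheck nP ν m l k) ν := by
  simp only [funext (h.gain_eq m l k)]
  exact (integrable_integral_dotProduct (h.law l) (h.indep l) _ _).1

theorem IsRicianModel.integral_gain (h : S.IsRicianModel gcheck nP ν) (m : Fin M) (l k : Fin K) :
    ∫ ω, S.gain gcheck nP ν m l k ω ∂ν = trace (AffineVec.moment S.noiseCov (S.channelVec m k)
      (S.precoderVec (S.etaBar m l) m l)) := by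
  simp only [h.gain_eq m l k]
  exact (integrable_integral_dotProduct (h.law l) (h.indep l) _ _).2

theorem IsRicianModel.integrable_sq_sum_gain (h : S.IsRicianModel gcheck nP ν) (l k : Fin K) :
    Integrable (fun ω => ‖∑ m, S.gain gcheck nP ν m l k ω‖ ^ 2) ν := by
  simp only [h.gain_eq _ l k]
  exact (integrable_integral_norm_sum_dotProduct (h.law l) (h.indep l)
    (fun m => S.precoderVec (S.etaBar m l) m l) (fun m => S.channelVec m k)).1

/-- The mean part yields `|∑ λ|²` since conjugation preserves the norm; the per-AP traces supply
`μ`, `ω` and the subtracted `∑ |λ|²`. -/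
theorem IsRicianModel.integral_sq_sum_gain (h : S.IsRicianModel gcheck nP ν) (l k : Fin K) :
    ((∫ ω, ‖∑ m, S.gain gcheck nP ν m l k ω‖ ^ 2 ∂ν : ℝ) : ℂ)
      = (∑ m, S.mu m k l) + (if l ∈ S.P k then ∑ m, S.omega m k l else 0)
        + ((‖∑ m, S.lam m k l‖ ^ 2 - ∑ m, ‖S.lam m k l‖ ^ 2 : ℝ) : ℂ) := by
  simp only [h.gain_eq _ l k]
  rw [integral_norm_sum_dotProduct_of_uncorrelated (h.law l) (h.indep l)
    (fun m => S.precoderVec (S.etaBar m l) m l) (fun m => S.channelVec m k)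
    (fun m => (S.etaBar m l : ℂ) ^ 2 • (S.W m l * S.Rtilde m l * (S.W m l)ᴴ))
    (fun m => S.R m k) (S.cov_precoderVec (S.etaBar · l) l) (S.cov_channelVec k)]
  simp only [trace_moment_eq_conj_lam _ _ _ (h.conjTranspose_R _ _)]
  rw [← map_sum, Complex.norm_conj]
  have hterm (m : Fin M) :
      trace (S.R m k * ((S.etaBar m l : ℂ) ^ 2 • (S.W m l * S.Rtilde m l * (S.W m l)ᴴ)))
        + trace (S.R m k * vecMulVec (S.precoderVec (S.etaBar m l) m l).1
            (star (S.precoderVec (S.etaBar m l) m l).1))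
        + trace (vecMulVec (S.channelVec m k).1 (star (S.channelVec m k).1)
            * ((S.etaBar m l : ℂ) ^ 2 • (S.W m l * S.Rtilde m l * (S.W m l)ᴴ)))
      = S.mu m k l + (if l ∈ S.P k then S.omega m k l else 0)
        - ((‖S.lam m k l‖ ^ 2 : ℝ) : ℂ) := by
    have hcyc (B C : Matrix (Fin N) (Fin N) ℂ) : trace (B * (S.W m l * C * (S.W m l)ᴴ))
        = trace ((S.W m l)ᴴ * B * S.W m l * C) := by
      rw [← Matrix.mul_assoc, trace_mul_comm]
      simp only [Matrix.mul_assoc]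
    have hG : vecMulVec (S.precoderVec (S.etaBar m l) m l).1
          (star (S.precoderVec (S.etaBar m l) m l).1)
        = (S.etaBar m l : ℂ) ^ 2 • (S.W m l * S.Gbar m l l * (S.W m l)ᴴ) := by
      simp only [precoderVec, star_smul, smul_vecMulVec, vecMulVec_smul, Gbar, mul_vecMulVec,
        vecMulVec_mul, star_mulVec, Complex.star_def, Complex.conj_ofReal, smul_smul, pow_two]
    rw [mu_add_omega_sub_lam m k l (h.conjTranspose_R m k), hG]
    simp only [Matrix.mul_smul, trace_smul, smul_eq_mul, hcyc]
    rfl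
  simp only [hterm, Finset.sum_sub_distrib, Finset.sum_add_distrib]
  have hite : ∑ m, (if l ∈ S.P k then S.omega m k l else 0)
      = if l ∈ S.P k then ∑ m, S.omega m k l else 0 := by split_ifs <;> simp
  rw [hite]
  push_cast
  ring

theorem IsRicianModel.sinrNum_eq (h : S.IsRicianModel gcheck nP ν) (k : Fin K) :
    S.sinrNum gcheck nP ν k = S.closedNum k := by
  simp only [sinrNum, closedNum, h.integral_gain, trace_moment_self]

theorem IsRicianModel.sinrDen_eq (h : S.IsRicianModel gcheck nP ν) (k : Fin K) :
    ((S.sinrDen gcheck nP ν k : ℝ) : ℂ) = S.closedDen k := by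
  have hd : S.sinrDen gcheck nP ν k = (∑ l, (∫ ω, ‖∑ m, S.gain gcheck nP ν m l k ω‖ ^ 2 ∂ν))
      - S.closedNum k + S.noise := by
    rw [← h.sinrNum_eq k]; rfl
  rw [hd, closedDen, Complex.ofReal_add, Complex.ofReal_sub, Complex.ofReal_sum]
  simp only [h.integral_sq_sum_gain, Finset.sum_add_distrib]
  rw [← Finset.sum_filter, Finset.filter_univ_mem]

/-- The summand `l = k` alone dominates the squared mean, by Jensen for the square; the other
summands are nonnegative and the noise power is positive. -/
theorem IsRicianModel.sinrDen_pos (h : S.IsRicianModel gcheck nP ν) (k : Fin K) :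
    0 < S.sinrDen gcheck nP ν k := by
  have hmean : ∫ ω, ∑ m, S.gain gcheck nP ν m k k ω ∂ν = ∑ m, ∫ ω, S.gain gcheck nP ν m k k ω ∂ν :=
    integral_finsetSum _ fun m _ => h.integrable_gain m k k
  have hnonneg (l : Fin K) : 0 ≤ ∫ ω, ‖∑ m, S.gain gcheck nP ν m l k ω‖ ^ 2 ∂ν :=
    integral_nonneg fun ω => by positivity
  have hsum := Finset.single_le_sum (fun l _ => hnonneg l) (Finset.mem_univ k)
  have hvar : ‖∑ m, ∫ ω, S.gain gcheck nP ν m k k ω ∂ν‖ ^ 2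
      ≤ ∫ ω, ‖∑ m, S.gain gcheck nP ν m k k ω‖ ^ 2 ∂ν := by
    rw [← hmean]
    have hint : Integrable (fun ω => ∑ m, S.gain gcheck nP ν m k k ω) ν :=
      integrable_finsetSum _ fun m _ => h.integrable_gain m k k
    calc ‖∫ ω, ∑ m, S.gain gcheck nP ν m k k ω ∂ν‖ ^ 2
        ≤ (∫ ω, ‖∑ m, S.gain gcheck nP ν m k k ω‖ ∂ν) ^ 2 := by
          gcongr; exact norm_integral_le_integral_norm _
      _ ≤ _ := (even_two.convexOn_pow).map_integral_le (continuous_pow 2).continuousOn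
          isClosed_univ (.of_forall fun _ => Set.mem_univ _) hint.norm
          (h.integrable_sq_sum_gain k k)
  have := S.noise_pos
  unfold sinrDen
  linarith

end Model

end Network

end CellFree

end

theorem theorem3 {M K N : ℕ} (S : CellFree.Network M K N)
    {Ω : Type*} [MeasurableSpace Ω] (ν : Measure Ω) [IsProbabilityMeasure ν]
    (gcheck nP : Fin M → Fin K → Ω → Fin N → ℂ)
    (hmodel : S.IsRicianModel gcheck nP ν) :
    -- the power normalization, with the expectation that it involves
    (∀ m k, Integrable (fun ω => ‖WithLp.toLp 2 (S.fbar gcheck nP m k ω)‖ ^ 2) ν ∧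
      ((S.meanSqPrecoder gcheck nP ν m k : ℝ) : ℂ) = S.powerTrace m k ∧
      S.eta gcheck nP ν m k = S.etaBar m k) ∧
    -- the expectations in the SINR exist
    (∀ m l k, Integrable (S.gain gcheck nP ν m l k) ν) ∧
    (∀ l k, Integrable (fun ω => ‖∑ m, S.gain gcheck nP ν m l k ω‖ ^ 2) ν) ∧
    -- the closed form of the SINR and of the spectral efficiency
    (∀ k, 0 < S.sinrDen gcheck nP ν k ∧
      S.sinrNum gcheck nP ν k = S.closedNum k ∧
      ((S.sinrDen gcheck nP ν k : ℝ) : ℂ) = S.closedDen k ∧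
      ((S.sinr gcheck nP ν k : ℝ) : ℂ) = S.closedSinr k ∧
      S.se gcheck nP ν k = S.closedSe k) := by
  refine ⟨fun m k => ⟨(hmodel.integrable_meanSqPrecoder m k).1,
    (hmodel.integrable_meanSqPrecoder m k).2, hmodel.eta_eq m k⟩, hmodel.integrable_gain,
    hmodel.integrable_sq_sum_gain, fun k => ?_⟩
  have hsinr : ((S.sinr gcheck nP ν k : ℝ) : ℂ) = S.closedSinr k := by
    rw [CellFree.Network.sinr, CellFree.Network.closedSinr, Complex.ofReal_div,
      hmodel.sinrNum_eq, hmodel.sinrDen_eq]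
  refine ⟨hmodel.sinrDen_pos k, hmodel.sinrNum_eq k, hmodel.sinrDen_eq k, hsinr, ?_⟩
  rw [CellFree.Network.se, CellFree.Network.closedSe, ← hsinr, Complex.ofReal_re]
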